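/- **Setting.** Let $\langle\mathcal S,\mathcal A,T,r,\gamma\rangle$ be a Markov decision process with discount factor $\gamma\in(0,1)$, transition kernel $T(ds'\mid s,a)$, bounded measurable reward $r:\mathcal S\times\mathcal A\to\mathbb R$, and a separable metric action space $\mathcal A$; let $\rho_0$ be an initial state distribution. Let $N\ge 1$ be the number of episodes and let $\pi^1,\dots,\pi^N$ be given (stochastic or deterministic, stationary) policies. In episode $e$ an infinite trajectory $(s_i^e,a_i^e)_{i\ge 0}$ is sampled with $s^e_0\sim\rho_0$, $a^e_i\sim\pi^e(\cdot\mid s^e_i)$, $s^e_{i+1}\sim T(\cdot\mid s^e_i,a^e_i)$, independently across episodes. Let $\hat Q:\mathcal S\times\mathcal A\to\mathbb R$ be a given measurable function. The policies and $\hat Q$ are fixed; the probability below is over the sampled trajectories. For a policy $\pi$ put $$Q^\pi(s,a)=\mathbb E\Big[\sum_{i\ge0}\gamma^i r(s_i,a_i)\,\Big|\,s_0=s,\ a_0=a,\ s_{i+1}\sim T(\cdot\mid s_i,a_i),\ a_{i+1}\sim\pi(\cdot\mid s_{i+1})\Big],$$ $$(\mathcal B^\pi Q)(s,a)=r(s,a)+\gamma\,\mathbb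 E_{s'\sim T(\cdot|s,a),\,a'\sim\pi(\cdot|s')}Q(s',a').$$ Let $\rho^{\pi}_{\rho_0}=(1-\gamma)\sum_{i\ge0}\gamma^i\rho_i$, where $\rho_i$ is the law of $s_i$ under $(\rho_0,\pi,T)$, and let $$\pi^D_0(\cdot\mid s)=\frac{\sum_{e=1}^N\rho^{\pi^e}_{\rho_0}(s)\,\pi^e(\cdot\mid s)}{\sum_{e=1}^N\rho^{\pi^e}_{\rho_0}(s)}$$ be the averaged behavior policy, where the occupancy measures are identified with their densities with respect to a common dominating measure. For $f:\mathcal S\times\mathcal A\to\mathbb R$ put $\tilde E_0^\infty f=\frac1N\sum_{e=1}^N\sum_{i=0}^\infty(1-\gamma)\gamma^i f(s^e_i,a^e_i)$, and let $$\epsilon^{0,\infty}_{\hat Q}=\tilde E_0^\infty\big|\hat Q-\mathcal B^{\pi^N}\hat Q\big|,\qquad W_1^{0,\infty}=\tilde E_0^\infty\big[(s,a)\mapsto W_1\big(\pi^N(\cdot\mid s),\pi^D_0(\cdot\mid s)\big)\big],$$ where $W_1$ is the 1-Wasserstein distance between probability measures on $\mathcal A$. **Theorem.** Assume that 1. for each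 $s\in\mathcal S$, $\hat Q(s,\cdot)$ and $Q^{\pi^N}(s,\cdot)$ are $L_{\mathcal A}$-Lipschitz; 2. $\hat Q$ and $Q^{\pi^N}$ take values in $[0,r^{\max}/(1-\gamma)]$; 3. $\mathcal A$ is bounded, with diameter $\mathrm{diam}_{\mathcal A}<\infty$. Then for every $\delta\in(0,1)$, with probability at least $1-\delta$, $$\mathbb E_{s_0\sim\rho_0,\,a_0\sim\pi^D_0(\cdot|s_0)}\big|\hat Q(s_0,a_0)-Q^{\pi^N}(s_0,a_0)\big|\le\frac{r^{\max}}{1-\gamma}\sqrt{\frac1{2N}\log\frac2\delta}+\Big(\frac{r^{\max}}{(1-\gamma)^2}+\frac{2L_{\mathcal A}\,\mathrm{diam}_{\mathcal A}}{1-\gamma}\Big)\sqrt{\frac2N\log\frac2\delta}+\frac1{1-\gamma}\Big(\epsilon^{0,\infty}_{\hat Q}+2L_{\mathcal A}W_1^{0,\infty}\Big).$$ -/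

import Mathlib

open MeasureTheory ProbabilityTheory
open scoped ENNReal NNReal

noncomputable section

namespace OffPolicy

variable {S A : Type*} [MeasurableSpace S] [MeasurableSpace A]

/-- One step of the Markov chain of state-action pairs:
from `(s, a)` draw `s' ∼ T(· | s, a)` and then `a' ∼ π(· | s')`. -/
def stepKernel (T : Kernel (S × A) S) (π : Kernel S A) : Kernel (S × A) (S × A) :=
  T ⊗ₖ Kernel.prodMkLeft (S × A) π

instance (T : Kernel (S × A) S) [IsMarkovKernel T] (π : Kernel S A) [IsMarkovKernel π] :
    IsMarkovKernel (stepKernel T π) := by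
  unfold stepKernel; infer_instance

/-- The one-step kernel as a function of the whole history; only the last pair matters. -/
def historyKernel (T : Kernel (S × A) S) (π : Kernel S A) (n : ℕ) :
    Kernel ((_ : Finset.Iic n) → S × A) (S × A) :=
  (stepKernel T π).comap (fun h => h ⟨n, Finset.mem_Iic.2 le_rfl⟩) (measurable_pi_apply _)

instance (T : Kernel (S × A) S) [IsMarkovKernel T] (π : Kernel S A) [IsMarkovKernel π] (n : ℕ) :
    IsMarkovKernel (historyKernel T π n) := by
  unfold historyKernel; infer_instance

/-- Law of the infinite trajectory `(s_i, a_i)_{i ≥ 0}` whose first pair has law `ν` and which then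
follows the transition kernel `T` and the stationary policy `π`. -/
def trajFrom (T : Kernel (S × A) S) [IsMarkovKernel T] (π : Kernel S A) [IsMarkovKernel π]
    (ν : Measure (S × A)) : Measure (ℕ → S × A) :=
  Kernel.trajMeasure (X := fun _ => S × A) ν (historyKernel T π)

/-- Law of the infinite trajectory with `s_0 ∼ ρ₀`, `a_i ∼ π(· | s_i)`,
`s_{i+1} ∼ T(· | s_i, a_i)`. -/
def trajLaw (T : Kernel (S × A) S) [IsMarkovKernel T] (ρ₀ : Measure S)
    (π : Kernel S A) [IsMarkovKernel π] : Measure (ℕ → S × A) :=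
  trajFrom T π (ρ₀ ⊗ₘ π)

/-- The Q function: expected discounted sum of rewards along the trajectory that starts with the
state `s_0 = s` and the action `a_0 = a` and follows `π` afterwards. -/
def qFunction (γ : ℝ) (T : Kernel (S × A) S) [IsMarkovKernel T] (r : S × A → ℝ)
    (π : Kernel S A) [IsMarkovKernel π] (p : S × A) : ℝ :=
  ∫ x, ∑' i : ℕ, γ ^ i * r (x i) ∂(trajFrom T π (Measure.dirac p))

/-- The Bellman operator of the policy `π`. -/
def bellman (γ : ℝ) (T : Kernel (S × A) S) (r : S × A → ℝ) (π : Kernel S A)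
    (Q : S × A → ℝ) (p : S × A) : ℝ :=
  r p + γ * ∫ s', ∫ a', Q (s', a') ∂(π s') ∂(T p)

/-- State distribution at step `i` of the trajectory generated by `(ρ₀, π, T)`. -/
def stateLaw (T : Kernel (S × A) S) [IsMarkovKernel T] (ρ₀ : Measure S)
    (π : Kernel S A) [IsMarkovKernel π] (i : ℕ) : Measure S :=
  (trajLaw T ρ₀ π).map (fun x => (x i).1)

/-- Normalized discounted state occupancy measure generated by `(ρ₀, π, T)`. -/
def stateOccupancy (γ : ℝ) (T : Kernel (S × A) S) [IsMarkovKernel T] (ρ₀ : Measure S)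
    (π : Kernel S A) [IsMarkovKernel π] : Measure S :=
  Measure.sum fun i : ℕ => ENNReal.ofReal ((1 - γ) * γ ^ i) • stateLaw T ρ₀ π i

section Behavior

variable {N : ℕ}

/-- Density at `s` of the occupancy measure of the policy of episode `e`, with respect to the sum
of the occupancy measures of all the episodes. -/
def occupancyDensity (γ : ℝ) (T : Kernel (S × A) S) [IsMarkovKernel T] (ρ₀ : Measure S)
    (π : Fin N → Kernel S A) [∀ e, IsMarkovKernel (π e)] (e : Fin N) (s : S) : ℝ≥0∞ :=
  (stateOccupancy γ T ρ₀ (π e)).rnDeriv (Measure.sum fun j => stateOccupancy γ T ρ₀ (π j)) s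

open Classical in
/-- The weight of episode `e` at the state `s`: its occupancy density. On the null set where the
total density is zero or infinite, so that it cannot be normalized, all the weights are one. -/
def episodeWeight (γ : ℝ) (T : Kernel (S × A) S) [IsMarkovKernel T] (ρ₀ : Measure S)
    (π : Fin N → Kernel S A) [∀ e, IsMarkovKernel (π e)] (e : Fin N) (s : S) : ℝ≥0∞ :=
  if (∑ j, occupancyDensity γ T ρ₀ π j s) = 0 ∨ (∑ j, occupancyDensity γ T ρ₀ π j s) = ∞ then 1
  else occupancyDensity γ T ρ₀ π e s

lemma measurable_occupancyDensity (γ : ℝ) (T : Kernel (S × A) S) [IsMarkovKernel T]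
    (ρ₀ : Measure S) (π : Fin N → Kernel S A) [∀ e, IsMarkovKernel (π e)] (e : Fin N) :
    Measurable (occupancyDensity γ T ρ₀ π e) :=
  Measure.measurable_rnDeriv _ _

lemma measurable_episodeWeight (γ : ℝ) (T : Kernel (S × A) S) [IsMarkovKernel T]
    (ρ₀ : Measure S) (π : Fin N → Kernel S A) [∀ e, IsMarkovKernel (π e)] (e : Fin N) :
    Measurable (episodeWeight γ T ρ₀ π e) := by
  classical
  have h : Measurable fun s => ∑ j, occupancyDensity γ T ρ₀ π j s :=
    Finset.measurable_sum _ fun j _ => measurable_occupancyDensity γ T ρ₀ π j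
  exact Measurable.ite ((h (measurableSet_singleton 0)).union (h (measurableSet_singleton ∞)))
    measurable_const (measurable_occupancyDensity γ T ρ₀ π e)

/-- The behavior policy at step `0`, i.e. the average of the policies of the episodes weighted by
their occupancy measures:
`π_D(· | s) = (∑ₑ ρ^{πₑ}(s) πₑ(· | s)) / (∑ₑ ρ^{πₑ}(s))`. -/
def behaviorPolicy (γ : ℝ) (T : Kernel (S × A) S) [IsMarkovKernel T] (ρ₀ : Measure S)
    (π : Fin N → Kernel S A) [∀ e, IsMarkovKernel (π e)] : Kernel S A where
  toFun s := (∑ e, episodeWeight γ T ρ₀ π e s)⁻¹ • ∑ e, episodeWeight γ T ρ₀ π e s • π e s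
  measurable' := by
    refine Measure.measurable_of_measurable_coe _ fun B hB => ?_
    simp only [Measure.smul_apply, Measure.coe_finsetSum, Finset.sum_apply, smul_eq_mul]
    exact (Finset.measurable_sum _ fun e _ => measurable_episodeWeight γ T ρ₀ π e).inv.mul
      (Finset.measurable_sum _ fun e _ =>
        (measurable_episodeWeight γ T ρ₀ π e).mul ((π e).measurable_coe hB))

/-- The averaging-discounted operator over `N` infinite trajectories. -/
def empiricalAverage (γ : ℝ) (x : Fin N → ℕ → S × A) (f : S × A → ℝ) : ℝ :=
  (1 / (N : ℝ)) * ∑ e, ∑' i : ℕ, (1 - γ) * γ ^ i * f (x e i)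

end Behavior

/-- The 1-Wasserstein distance: infimum over all couplings of the expected distance. -/
def wasserstein1 [PseudoEMetricSpace A] (μ ν : Measure A) : ℝ :=
  (⨅ (c : Measure (A × A)) (_ : c.map Prod.fst = μ ∧ c.map Prod.snd = ν),
    ∫⁻ p, edist p.1 p.2 ∂c).toReal

end OffPolicy

end

/-!
Write `D = |Q̂ - Q^π|` with `π` the last policy. Since `Q^π` is a fixed point of the Bellman operator
(`OffPolicy.qFunction_eq_bellman`), `D` is at most the Bellman residual of `Q̂` plus `γ` times the
expectation of `D` at the next state under an action of `π`. Replacing that action by one of the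
behavior policy costs the gap between the two averages of `D(s, ·)`, which is at most
`2 L W₁` because `D(s, ·)` is `2 L`-Lipschitz (`OffPolicy.abs_integral_sub_le_wasserstein1`).

Summed over the episodes, the state-action occupancy measures disintegrate as the sum of the state
occupancy measures followed by the behavior policy
(`OffPolicy.sum_stateOccupancy_compProd_behaviorPolicy`), and each state occupancy measure satisfies
the flow equation `ρ = (1 - γ) ρ₀ + γ T ∘ (ρ ⊗ π)` (`OffPolicy.stateOccupancy_eq_flow`). Integrating
the pointwise inequality against this sum, the averages of `D` on both sides cancel up to the
initial-time term. The result (`OffPolicy.integral_behaviorPolicy_le`) is the claimed bound with the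
empirical averages replaced by their expectations and without any deviation term.

The discounted sums along the episodes of the residual plus the gap are independent, take values in
`[0, 2 R + 2 L diam]` with `R = rmax / (1 - γ)`, and their means are the occupancy integrals above.
One-sided Hoeffding (`OffPolicy.exists_measurableSet_mean_le`) then gives a deviation term no larger
than the stated one. Concentration is applied to the gap and not to `W₁`: the gap is measurable in
the state, and it is bounded by `2 L W₁` only afterwards, along each sampled path, so that the
measurability of `s ↦ W₁(π(· | s), π_D(· | s))` is never needed.
-/

namespace OffPolicy

/-! ### One-step recursion for the trajectory laws -/

section Trajectory

variable {S A : Type*} [MeasurableSpace S] [MeasurableSpace A]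
  (T : Kernel (S × A) S) [IsMarkovKernel T] (π : Kernel S A) [IsMarkovKernel π]

instance (ν : Measure (S × A)) [IsProbabilityMeasure ν] :
    IsProbabilityMeasure (trajFrom T π ν) := by
  unfold trajFrom; infer_instance

instance (ρ₀ : Measure S) [IsProbabilityMeasure ρ₀] : IsProbabilityMeasure (trajLaw T ρ₀ π) := by
  unfold trajLaw; infer_instance

/-- Law of the state-action pair `(s_i, a_i)` along the trajectory started from `ν`. -/
noncomputable def pairLaw (ν : Measure (S × A)) (i : ℕ) : Measure (S × A) :=
  (trajFrom T π ν).map (fun x => x i)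

instance (ν : Measure (S × A)) [IsProbabilityMeasure ν] (i : ℕ) :
    IsProbabilityMeasure (pairLaw T π ν i) :=
  Measure.isProbabilityMeasure_map (measurable_pi_apply i).aemeasurable

lemma pairLaw_zero (ν : Measure (S × A)) : pairLaw T π ν 0 = ν := by
  have h : (fun x : ℕ → S × A => x 0)
      = (fun h : (_ : Finset.Iic 0) → S × A => h ⟨0, Finset.mem_Iic.2 le_rfl⟩)
        ∘ Preorder.frestrictLe (π := fun _ : ℕ => S × A) 0 := rfl
  unfold pairLaw trajFrom Kernel.trajMeasure
  rw [h, ← Measure.map_map (by fun_prop) (by fun_prop), Measure.map_comp _ _ (by fun_prop),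
    Kernel.traj_map_frestrictLe, Kernel.partialTraj_self, Measure.id_comp,
    Measure.map_map (by fun_prop) (by fun_prop)]
  exact Measure.map_id

lemma pairLaw_succ (ν : Measure (S × A)) [IsProbabilityMeasure ν] (i : ℕ) :
    pairLaw T π ν (i + 1) = stepKernel T π ∘ₘ pairLaw T π ν i := by
  have h := Kernel.map_frestrictLe_trajMeasure_compProd_eq_map_trajMeasure
    (X := fun _ => S × A) (μ₀ := ν) (κ := historyKernel T π) (a := i)
  have h2 := congrArg (fun m => m.map Prod.snd) h
  beta_reduce at h2
  rw [Measure.map_map (by fun_prop) (by fun_prop)] at h2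
  change Measure.snd _ = (trajFrom T π ν).map (fun x => x (i + 1)) at h2
  rw [Measure.snd_compProd] at h2
  unfold pairLaw
  rw [← h2]
  ext B hB
  rw [Measure.bind_apply hB (Kernel.aemeasurable _), Measure.bind_apply hB (Kernel.aemeasurable _),
    lintegral_map (Kernel.measurable_coe _ hB) (by fun_prop),
    lintegral_map (Kernel.measurable_coe _ hB) (by fun_prop)]
  rfl

/-- The state moves by `T`, and the action is then drawn from `π` at the new state. -/
lemma stepKernel_comp (μ : Measure (S × A)) [SFinite μ] :
    stepKernel T π ∘ₘ μ = (T ∘ₘ μ) ⊗ₘ π := by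
  ext B hB
  rw [Measure.bind_apply hB (Kernel.aemeasurable _), Measure.compProd_apply hB,
    Measure.lintegral_bind (Kernel.aemeasurable _)
      (Kernel.measurable_kernel_prodMk_left hB).aemeasurable]
  refine lintegral_congr fun p => ?_
  rw [stepKernel, Kernel.compProd_apply hB]
  rfl

end Trajectory

/-! ### Bounded measurable functions -/

/-- Bounded measurable real functions: the class of functions integrable against every finite
measure and stable under integration against Markov kernels. -/
structure BoundedMeasurable {α : Type*} [MeasurableSpace α] (f : α → ℝ) : Prop where
  measurable : Measurable f
  bounded : ∃ C : ℝ, ∀ x, |f x| ≤ C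

namespace BoundedMeasurable

variable {α β : Type*} [MeasurableSpace α] [MeasurableSpace β] {f g : α → ℝ}

lemma integrable (hf : BoundedMeasurable f) (μ : Measure α) [IsFiniteMeasure μ] :
    Integrable f μ := by
  obtain ⟨C, hC⟩ := hf.bounded
  exact Integrable.of_bound hf.measurable.aestronglyMeasurable C (.of_forall hC)

lemma add (hf : BoundedMeasurable f) (hg : BoundedMeasurable g) :
    BoundedMeasurable fun x => f x + g x := by
  obtain ⟨C, hC⟩ := hf.bounded
  obtain ⟨D, hD⟩ := hg.bounded
  exact ⟨hf.measurable.add hg.measurable,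
    C + D, fun x => (abs_add_le _ _).trans (add_le_add (hC x) (hD x))⟩

lemma sub (hf : BoundedMeasurable f) (hg : BoundedMeasurable g) :
    BoundedMeasurable fun x => f x - g x := by
  obtain ⟨C, hC⟩ := hf.bounded
  obtain ⟨D, hD⟩ := hg.bounded
  exact ⟨hf.measurable.sub hg.measurable,
    C + D, fun x => (abs_sub _ _).trans (add_le_add (hC x) (hD x))⟩

lemma const_mul (hf : BoundedMeasurable f) (c : ℝ) : BoundedMeasurable fun x => c * f x := by
  obtain ⟨C, hC⟩ := hf.bounded
  refine ⟨hf.measurable.const_mul c, |c| * C, fun x => ?_⟩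
  rw [abs_mul]
  exact mul_le_mul_of_nonneg_left (hC x) (abs_nonneg c)

lemma abs (hf : BoundedMeasurable f) : BoundedMeasurable fun x => |f x| := by
  obtain ⟨C, hC⟩ := hf.bounded
  exact ⟨hf.measurable.abs, C, fun x => by simpa using hC x⟩

lemma comp (hf : BoundedMeasurable f) {u : β → α} (hu : Measurable u) :
    BoundedMeasurable fun x => f (u x) := by
  obtain ⟨C, hC⟩ := hf.bounded
  exact ⟨hf.measurable.comp hu, C, fun x => hC _⟩

lemma integral_kernel_prod {f : α × β → ℝ} (hf : BoundedMeasurable f) (κ : Kernel α β)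
    [IsMarkovKernel κ] : BoundedMeasurable fun x => ∫ y, f (x, y) ∂(κ x) := by
  obtain ⟨C, hC⟩ := hf.bounded
  refine ⟨(hf.measurable.stronglyMeasurable.integral_kernel_prod_right' (κ := κ)).measurable,
    C, fun x => ?_⟩
  simpa using norm_integral_le_of_norm_le_const (μ := κ x) (f := fun y => f (x, y))
    (.of_forall fun y => hC (x, y))

lemma integral_kernel {f : β → ℝ} (hf : BoundedMeasurable f) (κ : Kernel α β)
    [IsMarkovKernel κ] : BoundedMeasurable fun x => ∫ y, f y ∂(κ x) :=
  (hf.comp measurable_snd).integral_kernel_prod κ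

lemma integral_comp {f : β → ℝ} (hf : BoundedMeasurable f) (κ : Kernel α β)
    [IsMarkovKernel κ] (μ : Measure α) [IsFiniteMeasure μ] :
    ∫ y, f y ∂(κ ∘ₘ μ) = ∫ x, ∫ y, f y ∂(κ x) ∂μ := by
  rw [← Measure.snd_compProd, Measure.snd, integral_map (by fun_prop)
    hf.measurable.aestronglyMeasurable,
    Measure.integral_compProd ((hf.comp measurable_snd).integrable _)]

end BoundedMeasurable

lemma summable_geometric_mul {γ : ℝ} (hγ : γ ∈ Set.Ioo (0 : ℝ) 1) {u : ℕ → ℝ} {C : ℝ}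
    (hu : ∀ i, |u i| ≤ C) : Summable fun i => γ ^ i * u i := by
  refine Summable.of_norm_bounded
    ((summable_geometric_of_lt_one hγ.1.le hγ.2).mul_right C) fun i => ?_
  rw [norm_mul, norm_pow, Real.norm_of_nonneg hγ.1.le]
  exact mul_le_mul_of_nonneg_left (hu i) (pow_nonneg hγ.1.le i)

/-- Discounted sums of a bounded function along a path are integrated term by term. -/
lemma integral_discounted_sum {α Ω : Type*} [MeasurableSpace α] [MeasurableSpace Ω] {γ : ℝ}
    (hγ : γ ∈ Set.Ioo (0 : ℝ) 1) {f : α → ℝ} (hf : BoundedMeasurable f)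
    (μ : Measure Ω) [IsProbabilityMeasure μ] {x : Ω → ℕ → α} (hx : ∀ i, Measurable fun ω => x ω i) :
    ∫ ω, ∑' i : ℕ, γ ^ i * f (x ω i) ∂μ = ∑' i : ℕ, γ ^ i * ∫ ω, f (x ω i) ∂μ := by
  obtain ⟨C, hC⟩ := hf.bounded
  have hb : ∀ i : ℕ, BoundedMeasurable fun ω => γ ^ i * f (x ω i) := fun i =>
    (hf.comp (hx i)).const_mul _
  have h := hasSum_integral_of_summable_integral_norm (μ := μ)
    (F := fun (i : ℕ) ω => γ ^ i * f (x ω i)) (fun i => (hb i).integrable μ) ?_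
  · rw [← h.tsum_eq]
    exact tsum_congr fun i => integral_const_mul _ _
  · have := summable_geometric_mul hγ (u := fun i => ∫ ω, |f (x ω i)| ∂μ) (C := C) fun i => by
      simpa using norm_integral_le_of_norm_le_const (μ := μ) (f := fun ω => |f (x ω i)|)
        (.of_forall fun ω => by simpa using hC (x ω i))
    refine this.congr fun i => ?_
    rw [← integral_const_mul]
    refine integral_congr_ae (.of_forall fun ω => ?_)
    simp [abs_of_pos hγ.1]

lemma measurable_discounted_sum {α Ω : Type*} [MeasurableSpace α] [MeasurableSpace Ω] {γ : ℝ}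
    (hγ : γ ∈ Set.Ioo (0 : ℝ) 1) {f : ℕ → α → ℝ} (hf : ∀ i, Measurable (f i)) {C : ℝ}
    (hC : ∀ i x, |f i x| ≤ C) {x : Ω → ℕ → α} (hx : ∀ i, Measurable fun ω => x ω i) :
    Measurable fun ω => ∑' i : ℕ, γ ^ i * f i (x ω i) := by
  refine measurable_of_tendsto_metrizable
    (f := fun (n : ℕ) ω => ∑ i ∈ Finset.range n, γ ^ i * f i (x ω i))
    (fun n => Finset.measurable_sum _ fun i _ => ((hf i).comp (hx i)).const_mul _) ?_
  rw [tendsto_pi_nhds]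
  exact fun ω => (summable_geometric_mul hγ fun i => hC i (x ω i)).hasSum.tendsto_sum_nat

/-! ### The Bellman equation for the Q function -/

section QFunction

variable {S A : Type*} [MeasurableSpace S] [MeasurableSpace A]
  (T : Kernel (S × A) S) (π : Kernel S A)

/-- Expected reward `i` steps ahead, as a function of the current state-action pair. -/
noncomputable def expectedReward (r : S × A → ℝ) : ℕ → S × A → ℝ
  | 0 => r
  | i + 1 => fun p => ∫ q, expectedReward r i q ∂(stepKernel T π p)

variable {r : S × A → ℝ}

lemma measurable_expectedReward (hr : Measurable r) (i : ℕ) :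
    Measurable (expectedReward T π r i) := by
  induction i with
  | zero => exact hr
  | succ i ih => exact ih.stronglyMeasurable.integral_kernel.measurable

variable [IsMarkovKernel T] [IsMarkovKernel π]

lemma abs_expectedReward_le {C : ℝ} (hC : ∀ p, |r p| ≤ C) (i : ℕ) (p : S × A) :
    |expectedReward T π r i p| ≤ C := by
  induction i generalizing p with
  | zero => exact hC p
  | succ i ih =>
    have h := norm_integral_le_of_norm_le_const (μ := stepKernel T π p)
      (f := expectedReward T π r i) (.of_forall ih)
    rwa [probReal_univ, mul_one] at h

lemma boundedMeasurable_expectedReward (hr : BoundedMeasurable r) (i : ℕ) :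
    BoundedMeasurable (expectedReward T π r i) :=
  ⟨measurable_expectedReward T π hr.measurable i,
    hr.bounded.imp fun _ hC => abs_expectedReward_le T π hC i⟩

lemma integral_expectedReward_pairLaw (hr : BoundedMeasurable r) (ν : Measure (S × A))
    [IsProbabilityMeasure ν] (i j : ℕ) :
    ∫ q, expectedReward T π r j q ∂(pairLaw T π ν i)
      = ∫ q, expectedReward T π r (i + j) q ∂ν := by
  induction i generalizing j with
  | zero => rw [pairLaw_zero, Nat.zero_add]
  | succ i ih =>
    rw [pairLaw_succ, (boundedMeasurable_expectedReward T π hr j).integral_comp]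
    have := ih (j + 1)
    rwa [← Nat.add_assoc, Nat.add_right_comm] at this

lemma qFunction_eq_tsum {γ : ℝ} (hγ : γ ∈ Set.Ioo (0 : ℝ) 1) (hr : BoundedMeasurable r)
    (p : S × A) : qFunction γ T r π p = ∑' i : ℕ, γ ^ i * expectedReward T π r i p := by
  unfold qFunction
  rw [integral_discounted_sum hγ hr _ fun i => measurable_pi_apply i]
  refine tsum_congr fun i => ?_
  have h := integral_expectedReward_pairLaw T π hr (Measure.dirac p) i 0
  rw [integral_dirac' _ _ (measurable_expectedReward T π hr.measurable _).stronglyMeasurable,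
    Nat.add_zero, pairLaw, integral_map (measurable_pi_apply i).aemeasurable
      (measurable_expectedReward T π hr.measurable 0).aestronglyMeasurable] at h
  rw [← h]
  rfl

lemma measurable_qFunction {γ : ℝ} (hγ : γ ∈ Set.Ioo (0 : ℝ) 1) (hr : BoundedMeasurable r) :
    Measurable (qFunction γ T r π) := by
  obtain ⟨C, hC⟩ := hr.bounded
  rw [funext (qFunction_eq_tsum T π hγ hr)]
  exact measurable_discounted_sum hγ (measurable_expectedReward T π hr.measurable)
    (abs_expectedReward_le T π hC) (x := fun p _ => p) fun _ => measurable_id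

lemma integral_stepKernel {f : S × A → ℝ} (hf : BoundedMeasurable f) (p : S × A) :
    ∫ q, f q ∂(stepKernel T π p) = ∫ s', ∫ a', f (s', a') ∂(π s') ∂(T p) := by
  rw [stepKernel, ProbabilityTheory.integral_compProd (hf.integrable _)]
  rfl

/-- The Q function is a fixed point of the Bellman operator. -/
lemma qFunction_eq_bellman {γ : ℝ} (hγ : γ ∈ Set.Ioo (0 : ℝ) 1) (hr : BoundedMeasurable r)
    (hQ : BoundedMeasurable (qFunction γ T r π)) (p : S × A) :
    qFunction γ T r π p = bellman γ T r π (qFunction γ T r π) p := by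
  obtain ⟨C, hC⟩ := hr.bounded
  rw [bellman, ← integral_stepKernel T π hQ, qFunction_eq_tsum T π hγ hr,
    (summable_geometric_mul hγ fun i => abs_expectedReward_le T π hC i p).tsum_eq_zero_add]
  congr 1
  · simp [expectedReward]
  · have h := hasSum_integral_of_summable_integral_norm (μ := stepKernel T π p)
      (F := fun (i : ℕ) q => γ ^ i * expectedReward T π r i q)
      (fun i => ((boundedMeasurable_expectedReward T π hr i).const_mul _).integrable _) ?_
    · rw [funext (qFunction_eq_tsum T π hγ hr), ← h.tsum_eq, ← tsum_mul_left]
      refine tsum_congr fun i => ?_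
      rw [integral_const_mul, pow_succ', mul_assoc]
      rfl
    · refine Summable.of_norm_bounded
        ((summable_geometric_of_lt_one hγ.1.le hγ.2).mul_right C) fun i => ?_
      rw [Real.norm_of_nonneg (integral_nonneg fun _ => norm_nonneg _)]
      refine (le_abs_self _).trans ?_
      simpa using norm_integral_le_of_norm_le_const (μ := stepKernel T π p)
        (f := fun q => ‖γ ^ i * expectedReward T π r i q‖) (C := γ ^ i * C)
        (.of_forall fun q => by
          rw [norm_norm, norm_mul, norm_pow, Real.norm_of_nonneg hγ.1.le]
          exact mul_le_mul_of_nonneg_left (abs_expectedReward_le T π hC i q)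
            (pow_nonneg hγ.1.le i))

end QFunction

/-! ### Discounted occupancy measures -/

section Occupancy

variable {S A : Type*} [MeasurableSpace S] [MeasurableSpace A]

/-- Normalized discounted occupancy measure on state-action pairs. -/
noncomputable def pairOccupancy (γ : ℝ) (T : Kernel (S × A) S) [IsMarkovKernel T] (ρ₀ : Measure S)
    (π : Kernel S A) [IsMarkovKernel π] : Measure (S × A) :=
  Measure.sum fun i : ℕ => ENNReal.ofReal ((1 - γ) * γ ^ i) • pairLaw T π (ρ₀ ⊗ₘ π) i

lemma tsum_ofReal_discount {γ : ℝ} (hγ : γ ∈ Set.Ioo (0 : ℝ) 1) :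
    ∑' i : ℕ, ENNReal.ofReal ((1 - γ) * γ ^ i) = 1 := by
  have h1 : 0 < 1 - γ := sub_pos.2 hγ.2
  rw [← ENNReal.ofReal_tsum_of_nonneg (fun i => by have := hγ.1; positivity)
    ((summable_geometric_of_lt_one hγ.1.le hγ.2).mul_left _), tsum_mul_left,
    tsum_geometric_of_lt_one hγ.1.le hγ.2, mul_inv_cancel₀ h1.ne', ENNReal.ofReal_one]

variable {γ : ℝ} (hγ : γ ∈ Set.Ioo (0 : ℝ) 1) (T : Kernel (S × A) S) [IsMarkovKernel T]
  (ρ₀ : Measure S) (π : Kernel S A) [IsMarkovKernel π]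

lemma fst_pairLaw (i : ℕ) : (pairLaw T π (ρ₀ ⊗ₘ π) i).fst = stateLaw T ρ₀ π i := by
  rw [pairLaw, Measure.fst, Measure.map_map (by fun_prop) (by fun_prop)]
  rfl

lemma fst_pairOccupancy : (pairOccupancy γ T ρ₀ π).fst = stateOccupancy γ T ρ₀ π := by
  rw [pairOccupancy, Measure.fst, Measure.map_sum (by fun_prop), stateOccupancy]
  congr 1
  ext1 i
  rw [Measure.map_smul]
  exact congrArg _ (fst_pairLaw T ρ₀ π i)

variable [IsProbabilityMeasure ρ₀]

include hγ in
lemma isProbabilityMeasure_pairOccupancy :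
    IsProbabilityMeasure (pairOccupancy γ T ρ₀ π) := by
  constructor
  simp [pairOccupancy, tsum_ofReal_discount hγ]

lemma pairLaw_eq_compProd (i : ℕ) :
    pairLaw T π (ρ₀ ⊗ₘ π) i = stateLaw T ρ₀ π i ⊗ₘ π := by
  rw [← fst_pairLaw]
  cases i with
  | zero => rw [pairLaw_zero, Measure.fst_compProd]
  | succ i => rw [pairLaw_succ, stepKernel_comp, Measure.fst_compProd]

instance (i : ℕ) : IsProbabilityMeasure (stateLaw T ρ₀ π i) := by
  rw [← fst_pairLaw]; infer_instance

lemma pairOccupancy_eq_compProd :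
    pairOccupancy γ T ρ₀ π = stateOccupancy γ T ρ₀ π ⊗ₘ π := by
  rw [stateOccupancy, Measure.compProd_sum_left, pairOccupancy]
  congr 1
  ext1 i
  rw [Measure.compProd_smul_left, pairLaw_eq_compProd]

include hγ in
/-- The flow equation of the occupancy measure: `ρ = (1 - γ) ρ₀ + γ T ∘ (ρ ⊗ π)`. -/
lemma stateOccupancy_eq_flow :
    stateOccupancy γ T ρ₀ π = ENNReal.ofReal (1 - γ) • ρ₀
      + ENNReal.ofReal γ • (T ∘ₘ pairOccupancy γ T ρ₀ π) := by
  have h0 : stateLaw T ρ₀ π 0 = ρ₀ := by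
    rw [← fst_pairLaw, pairLaw_zero, Measure.fst_compProd]
  have hs : ∀ i, stateLaw T ρ₀ π (i + 1) = T ∘ₘ pairLaw T π (ρ₀ ⊗ₘ π) i := fun i => by
    rw [← fst_pairLaw, pairLaw_succ, stepKernel_comp, Measure.fst_compProd]
  rw [pairOccupancy, Measure.bind_sum _ _ (Kernel.aemeasurable _)]
  ext B hB
  simp only [stateOccupancy, Measure.add_apply, Measure.smul_apply, Measure.sum_apply _ hB,
    smul_eq_mul]
  rw [tsum_eq_zero_add' ENNReal.summable, h0, pow_zero, mul_one, ← ENNReal.tsum_mul_left]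
  congr 1
  refine tsum_congr fun i => ?_
  rw [hs, Measure.comp_smul, Measure.smul_apply, smul_eq_mul, ← mul_assoc,
    ← ENNReal.ofReal_mul hγ.1.le]
  congr 2
  ring

include hγ in
lemma isProbabilityMeasure_stateOccupancy :
    IsProbabilityMeasure (stateOccupancy γ T ρ₀ π) := by
  have := isProbabilityMeasure_pairOccupancy hγ T ρ₀ π
  rw [← fst_pairOccupancy]; infer_instance

include hγ in
lemma integral_stateOccupancy {f : S → ℝ} (hf : BoundedMeasurable f) :
    ∫ s, f s ∂(stateOccupancy γ T ρ₀ π) = (1 - γ) * ∫ s, f s ∂ρ₀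
      + γ * ∫ p, ∫ s, f s ∂(T p) ∂(pairOccupancy γ T ρ₀ π) := by
  have := isProbabilityMeasure_pairOccupancy hγ T ρ₀ π
  rw [stateOccupancy_eq_flow hγ T ρ₀ π, integral_add_measure
    ((hf.integrable _).smul_measure ENNReal.ofReal_ne_top)
    ((hf.integrable _).smul_measure ENNReal.ofReal_ne_top), integral_smul_measure,
    integral_smul_measure, hf.integral_comp, ENNReal.toReal_ofReal (sub_pos.2 hγ.2).le,
    ENNReal.toReal_ofReal hγ.1.le, smul_eq_mul, smul_eq_mul]

include hγ in
/-- The mean of a discounted average along the trajectory is an occupancy integral. -/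
lemma integral_discounted_trajLaw {f : S × A → ℝ} (hf : BoundedMeasurable f) :
    ∫ x, ∑' i : ℕ, (1 - γ) * γ ^ i * f (x i) ∂(trajLaw T ρ₀ π)
      = ∫ p, f p ∂(pairOccupancy γ T ρ₀ π) := by
  have := isProbabilityMeasure_pairOccupancy hγ T ρ₀ π
  have h1 := hf.integrable (pairOccupancy γ T ρ₀ π)
  rw [pairOccupancy, integral_sum_measure h1]
  simp_rw [mul_assoc, tsum_mul_left]
  rw [integral_const_mul, integral_discounted_sum hγ hf _ fun i => measurable_pi_apply i,
    ← tsum_mul_left]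
  refine tsum_congr fun i => ?_
  have h2 : 0 ≤ (1 - γ) * γ ^ i :=
    mul_nonneg (sub_pos.2 hγ.2).le (pow_nonneg hγ.1.le i)
  rw [integral_smul_measure, ENNReal.toReal_ofReal h2, pairLaw,
    integral_map (measurable_pi_apply i).aemeasurable hf.measurable.aestronglyMeasurable,
    smul_eq_mul, mul_assoc]
  rfl

end Occupancy

/-! ### The behavior policy disintegrates the mixture of the occupancy measures -/

section Behavior

variable {S A : Type*} [MeasurableSpace S] [MeasurableSpace A] {N : ℕ} (γ : ℝ)
  (T : Kernel (S × A) S) [IsMarkovKernel T] (ρ₀ : Measure S)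
  (π : Fin N → Kernel S A) [∀ e, IsMarkovKernel (π e)]

lemma isMarkovKernel_behaviorPolicy (hN : 0 < N) :
    IsMarkovKernel (behaviorPolicy γ T ρ₀ π) := by
  refine ⟨fun s => ⟨?_⟩⟩
  change ((∑ e, episodeWeight γ T ρ₀ π e s)⁻¹ • ∑ e, episodeWeight γ T ρ₀ π e s • π e s) _ = 1
  simp only [Measure.smul_apply, Measure.coe_finsetSum, Finset.sum_apply, smul_eq_mul,
    measure_univ, mul_one]
  by_cases h : (∑ j, occupancyDensity γ T ρ₀ π j s) = 0 ∨ (∑ j, occupancyDensity γ T ρ₀ π j s) = ∞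
  · simp only [episodeWeight, if_pos h]
    refine ENNReal.inv_mul_cancel ?_ ?_
    · simpa using hN.ne'
    · simp
  · simp only [episodeWeight, if_neg h]
    rw [not_or] at h
    exact ENNReal.inv_mul_cancel h.1 h.2

variable [IsProbabilityMeasure ρ₀] {γ} (hγ : γ ∈ Set.Ioo (0 : ℝ) 1)

include hγ in
lemma sum_occupancyDensity_ae_eq_one :
    ∀ᵐ s ∂(Measure.sum fun j => stateOccupancy γ T ρ₀ (π j)),
      ∑ j, occupancyDensity γ T ρ₀ π j s = 1 := by
  have := fun e => isProbabilityMeasure_stateOccupancy hγ T ρ₀ (π e)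
  set σ := Measure.sum fun j => stateOccupancy γ T ρ₀ (π j) with hσ
  have hac : ∀ e, stateOccupancy γ T ρ₀ (π e) ≪ σ := fun e =>
    (Measure.le_sum _ e).absolutelyContinuous
  refine ae_eq_of_forall_setLIntegral_eq_of_sigmaFinite (μ := σ) (g := fun _ => 1)
    (Finset.measurable_sum _ fun j _ => measurable_occupancyDensity γ T ρ₀ π j)
    measurable_const fun B hB _ => ?_
  rw [lintegral_finsetSum _ fun j _ => measurable_occupancyDensity γ T ρ₀ π j, setLIntegral_one,
    hσ, Measure.sum_apply _ hB, tsum_fintype]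
  exact Finset.sum_congr rfl fun j _ => Measure.setLIntegral_rnDeriv (hac j) B

include hγ in
lemma sum_stateOccupancy_compProd_behaviorPolicy (hN : 0 < N) :
    (Measure.sum fun e => stateOccupancy γ T ρ₀ (π e)) ⊗ₘ behaviorPolicy γ T ρ₀ π
      = Measure.sum fun e => pairOccupancy γ T ρ₀ (π e) := by
  have := fun e => isProbabilityMeasure_stateOccupancy hγ T ρ₀ (π e)
  have := isMarkovKernel_behaviorPolicy γ T ρ₀ π hN
  ext B hB
  rw [Measure.compProd_apply hB, Measure.sum_apply _ hB, tsum_fintype]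
  have h1 : ∀ᵐ s ∂(Measure.sum fun j => stateOccupancy γ T ρ₀ (π j)),
      behaviorPolicy γ T ρ₀ π s (Prod.mk s ⁻¹' B)
        = ∑ e, occupancyDensity γ T ρ₀ π e s * π e s (Prod.mk s ⁻¹' B) := by
    filter_upwards [sum_occupancyDensity_ae_eq_one T ρ₀ π hγ] with s hs
    have hw : ∀ e, episodeWeight γ T ρ₀ π e s = occupancyDensity γ T ρ₀ π e s := fun e => by
      rw [episodeWeight, if_neg (by simp [hs])]
    change ((∑ e, episodeWeight γ T ρ₀ π e s)⁻¹ • ∑ e, episodeWeight γ T ρ₀ π e s • π e s) _ = _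
    simp [hw, hs]
  have hm := fun e => Kernel.measurable_kernel_prodMk_left (κ := π e) hB
  rw [lintegral_congr_ae h1, lintegral_finsetSum (f := fun e s =>
    occupancyDensity γ T ρ₀ π e s * π e s (Prod.mk s ⁻¹' B)) _ fun e _ =>
      (measurable_occupancyDensity γ T ρ₀ π e).mul (hm e)]
  refine Finset.sum_congr rfl fun e _ => ?_
  rw [pairOccupancy_eq_compProd, Measure.compProd_apply hB]
  exact lintegral_rnDeriv_mul (Measure.le_sum _ e).absolutelyContinuous
    (hm e).aemeasurable

include hγ in
/-- Summed over the episodes, averaging over the actions actually taken is the same as averaging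
over actions of the behavior policy. -/
lemma sum_integral_pairOccupancy (hN : 0 < N) {f : S × A → ℝ} (hf : BoundedMeasurable f) :
    ∑ e, ∫ p, f p ∂(pairOccupancy γ T ρ₀ (π e))
      = ∑ e, ∫ s, ∫ a, f (s, a) ∂(behaviorPolicy γ T ρ₀ π s)
          ∂(stateOccupancy γ T ρ₀ (π e)) := by
  have := fun e => isProbabilityMeasure_stateOccupancy hγ T ρ₀ (π e)
  have := fun e => isProbabilityMeasure_pairOccupancy hγ T ρ₀ (π e)
  have := isMarkovKernel_behaviorPolicy γ T ρ₀ π hN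
  have h := congrArg (fun m => ∫ p, f p ∂m)
    (sum_stateOccupancy_compProd_behaviorPolicy T ρ₀ π hγ hN)
  beta_reduce at h
  rw [Measure.integral_compProd (hf.integrable _), integral_sum_measure (hf.integrable _),
    integral_sum_measure ((hf.integral_kernel_prod _).integrable _), tsum_fintype,
    tsum_fintype] at h
  exact h.symm

end Behavior

/-! ### Wasserstein distance on a bounded space -/

section Wasserstein

variable {A : Type*} [MetricSpace A] [SecondCountableTopology A] [MeasurableSpace A]
  (μ ν : Measure A) [IsProbabilityMeasure μ] [IsProbabilityMeasure ν]

lemma iInf_coupling_le_ofReal_diam (hdiam : Bornology.IsBounded (Set.univ : Set A)) :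
    (⨅ (c : Measure (A × A)) (_ : c.map Prod.fst = μ ∧ c.map Prod.snd = ν),
      ∫⁻ p, edist p.1 p.2 ∂c) ≤ ENNReal.ofReal (Metric.diam (Set.univ : Set A)) := by
  refine (iInf₂_le (μ.prod ν) ⟨by simp, by simp⟩).trans ?_
  have h : ∀ p : A × A, edist p.1 p.2 ≤ ENNReal.ofReal (Metric.diam (Set.univ : Set A)) :=
    fun p => by
      rw [edist_dist]
      exact ENNReal.ofReal_le_ofReal (Metric.dist_le_diam_of_mem hdiam trivial trivial)
  simpa using lintegral_mono (μ := μ.prod ν) h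

lemma wasserstein1_le_diam (hdiam : Bornology.IsBounded (Set.univ : Set A)) :
    wasserstein1 μ ν ≤ Metric.diam (Set.univ : Set A) :=
  ENNReal.toReal_le_of_le_ofReal Metric.diam_nonneg (iInf_coupling_le_ofReal_diam μ ν hdiam)

/-- The easy half of Kantorovich–Rubinstein duality. -/
lemma abs_integral_sub_le_wasserstein1 (hdiam : Bornology.IsBounded (Set.univ : Set A))
    {K : ℝ≥0} {f : A → ℝ} (hf : LipschitzWith K f) (hfb : BoundedMeasurable f) :
    |∫ a, f a ∂μ - ∫ a, f a ∂ν| ≤ K * wasserstein1 μ ν := by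
  have hc : ∀ c : Measure (A × A), (c.map Prod.fst = μ ∧ c.map Prod.snd = ν) →
      ‖∫ a, f a ∂μ - ∫ a, f a ∂ν‖ₑ ≤ K * ∫⁻ p, edist p.1 p.2 ∂c := by
    rintro c ⟨h1, h2⟩
    have : IsProbabilityMeasure c :=
      ⟨by simpa [Measure.map_apply measurable_fst MeasurableSet.univ] using
        congrArg (fun m => m Set.univ) h1⟩
    have e1 : ∫ a, f a ∂μ = ∫ p, f p.1 ∂c := by
      rw [← h1, integral_map (by fun_prop) hfb.measurable.aestronglyMeasurable]
    have e2 : ∫ a, f a ∂ν = ∫ p, f p.2 ∂c := by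
      rw [← h2, integral_map (by fun_prop) hfb.measurable.aestronglyMeasurable]
    rw [e1, e2, ← integral_sub ((hfb.comp measurable_fst).integrable _)
      ((hfb.comp measurable_snd).integrable _), ← lintegral_const_mul' _ _ ENNReal.coe_ne_top]
    refine (enorm_integral_le_lintegral_enorm _).trans (lintegral_mono fun p => ?_)
    rw [← edist_eq_enorm_sub]
    exact hf p.1 p.2
  have hinf : ‖∫ a, f a ∂μ - ∫ a, f a ∂ν‖ₑ ≤
      K * ⨅ (c : Measure (A × A)) (_ : c.map Prod.fst = μ ∧ c.map Prod.snd = ν),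
        ∫⁻ p, edist p.1 p.2 ∂c := by
    rcases eq_or_ne K 0 with rfl | hK
    · simpa using hc (μ.prod ν) ⟨by simp, by simp⟩
    · have hK' : (K : ℝ≥0∞) ≠ 0 := by simpa using hK
      rw [← ENNReal.div_le_iff' hK' ENNReal.coe_ne_top]
      refine le_iInf₂ fun c h => ?_
      rw [ENNReal.div_le_iff' hK' ENNReal.coe_ne_top]
      exact hc c h
  have hfin := ne_top_of_le_ne_top ENNReal.ofReal_ne_top (iInf_coupling_le_ofReal_diam μ ν hdiam)
  have h := ENNReal.toReal_mono (ENNReal.mul_ne_top ENNReal.coe_ne_top hfin) hinf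
  rwa [toReal_enorm, ENNReal.toReal_mul, ENNReal.coe_toReal, Real.norm_eq_abs] at h

end Wasserstein

/-! ### The error bound in expectation -/

section Expectation

variable {S A : Type*} [MeasurableSpace S] [MeasurableSpace A]

/-- A function `D` that is contracted up to `ε` by the policy `πN` is controlled, under the initial
distribution and the behavior policy, by the occupancy integrals of `ε` and of the policy mismatch.
Integrating the contraction inequality against the sum of the occupancy measures makes the average
of `D` appear on both sides, and by the flow equation the difference is the initial-time term. -/
lemma integral_behaviorPolicy_le {N : ℕ} (hN : 0 < N) {γ : ℝ} (hγ : γ ∈ Set.Ioo (0 : ℝ) 1)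
    (T : Kernel (S × A) S) [IsMarkovKernel T] (ρ₀ : Measure S) [IsProbabilityMeasure ρ₀]
    (π : Fin N → Kernel S A) [∀ e, IsMarkovKernel (π e)] (πN : Kernel S A) [IsMarkovKernel πN]
    {D ε : S × A → ℝ} (hD : BoundedMeasurable D) (hε : BoundedMeasurable ε)
    (hstep : ∀ p, D p ≤ ε p + γ * ∫ s', ∫ a', D (s', a') ∂(πN s') ∂(T p)) :
    N * ((1 - γ) * ∫ s, ∫ a, D (s, a) ∂(behaviorPolicy γ T ρ₀ π s) ∂ρ₀)
      ≤ ∑ e, ∫ p, (ε p + |∫ a, D (p.1, a) ∂(πN p.1)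
          - ∫ a, D (p.1, a) ∂(behaviorPolicy γ T ρ₀ π p.1)|) ∂(pairOccupancy γ T ρ₀ (π e)) := by
  have := isMarkovKernel_behaviorPolicy γ T ρ₀ π hN
  have := fun e => isProbabilityMeasure_pairOccupancy hγ T ρ₀ (π e)
  set g : S → ℝ := fun s => ∫ a, D (s, a) ∂(behaviorPolicy γ T ρ₀ π s)
  set k : S → ℝ := fun s => ∫ a, D (s, a) ∂(πN s)
  have hg : BoundedMeasurable g := hD.integral_kernel_prod _
  have hk : BoundedMeasurable k := hD.integral_kernel_prod _
  have hh : BoundedMeasurable fun s => |k s - g s| := (hk.sub hg).abs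
  have hgh := hg.add hh
  have key : ∀ e, ∫ p, D p ∂(pairOccupancy γ T ρ₀ (π e)) + (1 - γ) * ∫ s, g s ∂ρ₀
      ≤ ∫ p, (ε p + |k p.1 - g p.1|) ∂(pairOccupancy γ T ρ₀ (π e))
        + ∫ s, g s ∂(stateOccupancy γ T ρ₀ (π e)) := by
    intro e
    have := isProbabilityMeasure_stateOccupancy hγ T ρ₀ (π e)
    set M := pairOccupancy γ T ρ₀ (π e)
    have h1 : ∫ p, D p ∂M ≤ ∫ p, ε p + γ * ∫ s, (g s + |k s - g s|) ∂(T p) ∂M := by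
      refine integral_mono (hD.integrable _)
        ((hε.add ((hgh.integral_kernel T).const_mul γ)).integrable _) fun p => ?_
      refine (hstep p).trans ?_
      refine add_le_add le_rfl (mul_le_mul_of_nonneg_left ?_ hγ.1.le)
      refine integral_mono (hk.integrable _) (hgh.integrable _) fun s => ?_
      have := le_abs_self (k s - g s)
      change k s ≤ g s + |k s - g s|
      linarith
    rw [integral_add (hε.integrable _) (((hgh.integral_kernel T).const_mul γ).integrable _),
      integral_const_mul] at h1
    have h2 := integral_stateOccupancy hγ T ρ₀ (π e) hgh
    rw [integral_add (hg.integrable _) (hh.integrable _),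
      integral_add (hg.integrable _) (hh.integrable _)] at h2
    have h3 : ∫ s, |k s - g s| ∂(stateOccupancy γ T ρ₀ (π e)) = ∫ p, |k p.1 - g p.1| ∂M := by
      rw [← fst_pairOccupancy, Measure.fst, integral_map (by fun_prop)
        hh.measurable.aestronglyMeasurable]
    have h4 : 0 ≤ (1 - γ) * ∫ s, |k s - g s| ∂ρ₀ :=
      mul_nonneg (sub_pos.2 hγ.2).le (integral_nonneg fun _ => abs_nonneg _)
    rw [integral_add (hε.integrable _) ((hh.comp measurable_fst).integrable _), ← h3]
    linarith
  have hsum := Finset.sum_le_sum fun e (_ : e ∈ Finset.univ) => key e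
  rw [Finset.sum_add_distrib, Finset.sum_add_distrib,
    sum_integral_pairOccupancy T ρ₀ π hγ hN hD, Finset.sum_const, Finset.card_univ,
    Fintype.card_fin, nsmul_eq_mul, add_comm] at hsum
  exact le_of_add_le_add_right hsum

lemma integral_integral_sub (T : Kernel (S × A) S) [IsMarkovKernel T] (π : Kernel S A)
    [IsMarkovKernel π] {f g : S × A → ℝ} (hf : BoundedMeasurable f) (hg : BoundedMeasurable g)
    (p : S × A) :
    ∫ s', ∫ a', f (s', a') - g (s', a') ∂(π s') ∂(T p)
      = ∫ s', ∫ a', f (s', a') ∂(π s') ∂(T p) - ∫ s', ∫ a', g (s', a') ∂(π s') ∂(T p) := by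
  rw [← integral_stepKernel T π hf, ← integral_stepKernel T π hg,
    ← integral_stepKernel T π (hf.sub hg), integral_sub (hf.integrable _) (hg.integrable _)]

variable (γ : ℝ) (T : Kernel (S × A) S) [IsMarkovKernel T] (π : Kernel S A) [IsMarkovKernel π]
  (r : S × A → ℝ) {f Q : S × A → ℝ}

/-- A fixed point `Q` of the Bellman operator satisfies
`f - Q = (f - B f) + γ E [f - Q]` for every bounded `f`. -/
lemma sub_eq_bellman_residual_add (hf : BoundedMeasurable f) (hQ : BoundedMeasurable Q)
    (hfix : ∀ p, Q p = bellman γ T r π Q p) (p : S × A) :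
    f p - Q p = (f p - bellman γ T r π f p)
      + γ * ∫ s', ∫ a', f (s', a') - Q (s', a') ∂(π s') ∂(T p) := by
  rw [integral_integral_sub T π hf hQ]
  have := hfix p
  rw [bellman] at this ⊢
  linarith

lemma abs_sub_le_bellman_residual_add (hγ : 0 ≤ γ) (hf : BoundedMeasurable f)
    (hQ : BoundedMeasurable Q) (hfix : ∀ p, Q p = bellman γ T r π Q p) (p : S × A) :
    |f p - Q p| ≤ |f p - bellman γ T r π f p|
      + γ * ∫ s', ∫ a', |f (s', a') - Q (s', a')| ∂(π s') ∂(T p) := by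
  have h := hf.sub hQ
  rw [sub_eq_bellman_residual_add γ T π r hf hQ hfix p, ← integral_stepKernel T π h,
    ← integral_stepKernel T π h.abs]
  refine (abs_add_le _ _).trans (add_le_add le_rfl ?_)
  rw [abs_mul, abs_of_nonneg hγ]
  exact mul_le_mul_of_nonneg_left (abs_integral_le_integral_abs) hγ

/-- The fixed point equation expresses the reward through `Q`, so that the Bellman residual is
bounded by the range of `f` and `Q`, whatever the size of the reward. -/
lemma abs_bellman_residual_le (hγ : γ ∈ Set.Ioo (0 : ℝ) 1) (hf : BoundedMeasurable f)
    (hQ : BoundedMeasurable Q) (hfix : ∀ p, Q p = bellman γ T r π Q p) {R : ℝ}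
    (hfR : ∀ p, f p ∈ Set.Icc 0 R) (hQR : ∀ p, Q p ∈ Set.Icc 0 R) (p : S × A) :
    |f p - bellman γ T r π f p| ≤ 2 * R := by
  have h := hf.sub hQ
  have hle : ∀ q, |f q - Q q| ≤ R := fun q => by
    rw [abs_le]
    constructor <;> linarith [(hfR q).1, (hfR q).2, (hQR q).1, (hQR q).2]
  have hR : 0 ≤ R := (abs_nonneg _).trans (hle p)
  have h1 : f p - bellman γ T r π f p
      = (f p - Q p) - γ * ∫ q, (f q - Q q) ∂(stepKernel T π p) := by
    rw [integral_stepKernel T π h]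
    linarith [sub_eq_bellman_residual_add γ T π r hf hQ hfix p]
  have h2 := norm_integral_le_of_norm_le_const (μ := stepKernel T π p)
    (f := fun q => f q - Q q) (.of_forall hle)
  rw [probReal_univ, mul_one, Real.norm_eq_abs] at h2
  rw [h1, two_mul]
  refine (abs_sub _ _).trans (add_le_add (hle p) ?_)
  rw [abs_mul, abs_of_pos hγ.1]
  exact (mul_le_mul hγ.2.le h2 (abs_nonneg _) zero_le_one).trans_eq (one_mul R)

lemma boundedMeasurable_bellman (hr : BoundedMeasurable r) (hf : BoundedMeasurable f) :
    BoundedMeasurable (bellman γ T r π f) :=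
  hr.add (((hf.integral_kernel_prod π).integral_kernel T).const_mul γ)

end Expectation

/-! ### Concentration of the empirical average -/

/-- One-sided Hoeffding inequality for the mean of independent variables with values in `[0, M]`. -/
lemma exists_measurableSet_mean_le {Ω : Type*} [MeasurableSpace Ω] (P : Measure Ω)
    [IsProbabilityMeasure P] {N : ℕ} (hN : 0 < N) {Z : Fin N → Ω → ℝ} (hind : iIndepFun Z P)
    (hZ : ∀ e, AEMeasurable (Z e) P) {M : ℝ} (hM : ∀ e ω, Z e ω ∈ Set.Icc 0 M)
    {δ : ℝ} (hδ : δ ∈ Set.Ioo (0 : ℝ) 1) :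
    ∃ E : Set Ω, MeasurableSet E ∧ ENNReal.ofReal (1 - δ) ≤ P E ∧ ∀ ω ∈ E,
      1 / (N : ℝ) * ∑ e, ∫ ω', Z e ω' ∂P
        ≤ 1 / (N : ℝ) * ∑ e, Z e ω + M * √(1 / (2 * N) * Real.log (1 / δ)) := by
  have hN' : (0 : ℝ) < N := by exact_mod_cast hN
  have hlog : 0 ≤ Real.log (1 / δ) := Real.log_nonneg (by
    rw [le_div_iff₀ hδ.1, one_mul]; exact hδ.2.le)
  set t := √(1 / (2 * N) * Real.log (1 / δ)) with ht
  set bad : Set Ω := {ω | N * (M * t) < ∑ e, (∫ ω', Z e ω' ∂P - Z e ω)} with hbad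
  have hPbad : P.real bad ≤ δ := by
    obtain ⟨ω₀⟩ : Nonempty Ω := nonempty_of_isProbabilityMeasure P
    have hM0 : 0 ≤ M := (hM ⟨0, hN⟩ ω₀).1.trans (hM ⟨0, hN⟩ ω₀).2
    rcases hM0.eq_or_lt with rfl | hMpos
    · -- the sub-Gaussian tail bound degenerates, but all the variables vanish
      have hz : ∀ e ω, Z e ω = 0 := fun e ω => le_antisymm (hM e ω).2 (hM e ω).1
      have : bad = ∅ := by simp [hbad, hz]
      simpa [this] using hδ.1.le
    · have hsub : ∀ e ∈ Finset.univ, HasSubgaussianMGF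
          (fun ω => ∫ ω', Z e ω' ∂P - Z e ω) ((‖M - 0‖₊ / 2) ^ 2) P := fun e _ => by
        have := (hasSubgaussianMGF_of_mem_Icc (hZ e) (.of_forall (hM e))).neg
        refine this.congr (.of_forall fun ω => ?_)
        simp
      have hind' : iIndepFun (fun e ω => ∫ ω', Z e ω' ∂P - Z e ω) P :=
        hind.comp (fun e z => ∫ ω', Z e ω' ∂P - z) fun e => by fun_prop
      have h := HasSubgaussianMGF.measure_sum_ge_le_of_iIndepFun hind' hsub
        (ε := N * (M * t)) (by positivity)
      have hsubset : bad ⊆ {ω | N * (M * t) ≤ ∑ e, (∫ ω', Z e ω' ∂P - Z e ω)} :=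
        fun ω hω => by
          rw [hbad, Set.mem_ofPred_eq] at hω
          exact hω.le
      refine (measureReal_mono hsubset).trans (h.trans_eq ?_)
      have ht2 : t ^ 2 = 1 / (2 * N) * Real.log (1 / δ) := Real.sq_sqrt (by positivity)
      have hc : ((∑ e ∈ (Finset.univ : Finset (Fin N)), (‖M - 0‖₊ / 2) ^ 2 : ℝ≥0) : ℝ)
          = N * (M / 2) ^ 2 := by
        simp [abs_of_pos hMpos]
      have he : -(N * (M * t)) ^ 2 / (2 * (N * (M / 2) ^ 2)) = Real.log δ := by
        rw [mul_pow, mul_pow, ht2, one_div δ, Real.log_inv]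
        field_simp
      rw [hc, he, Real.exp_log hδ.1]
  refine ⟨(toMeasurable P bad)ᶜ, (measurableSet_toMeasurable P bad).compl, ?_, fun ω hω => ?_⟩
  · rw [prob_compl_eq_one_sub (measurableSet_toMeasurable P bad), measure_toMeasurable,
      ENNReal.ofReal_sub _ hδ.1.le, ENNReal.ofReal_one]
    refine tsub_le_tsub_left ?_ 1
    rw [← ENNReal.ofReal_toReal (measure_ne_top P bad)]
    exact ENNReal.ofReal_le_ofReal hPbad
  · have h : ω ∉ bad := fun h => hω (subset_toMeasurable P bad h)
    rw [hbad, Set.mem_ofPred_eq, not_lt, Finset.sum_sub_distrib] at h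
    have : 1 / (N : ℝ) * (∑ e, ∫ ω', Z e ω' ∂P - ∑ e, Z e ω) ≤ 1 / (N : ℝ) * (N * (M * t)) :=
      mul_le_mul_of_nonneg_left h (by positivity)
    rw [← mul_assoc (1 / (N : ℝ)) N, one_div_mul_cancel hN'.ne', one_mul, mul_sub] at this
    linarith

/-! ### Discounted averages along the sampled paths -/

section DiscountedAverage

variable {α : Type*} {γ : ℝ} (hγ : γ ∈ Set.Ioo (0 : ℝ) 1)

include hγ

lemma summable_discounted {u : ℕ → ℝ} {C : ℝ} (hu : ∀ i, |u i| ≤ C) :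
    Summable fun i => (1 - γ) * γ ^ i * u i := by
  simp_rw [mul_assoc]
  exact (summable_geometric_mul hγ hu).mul_left _

lemma tsum_discounted_mono {u v : ℕ → ℝ} {C D : ℝ} (hu : ∀ i, |u i| ≤ C) (hv : ∀ i, |v i| ≤ D)
    (huv : ∀ i, u i ≤ v i) :
    ∑' i : ℕ, (1 - γ) * γ ^ i * u i ≤ ∑' i : ℕ, (1 - γ) * γ ^ i * v i :=
  (summable_discounted hγ hu).tsum_le_tsum (fun i => mul_le_mul_of_nonneg_left (huv i)
    (mul_nonneg (sub_pos.2 hγ.2).le (pow_nonneg hγ.1.le i))) (summable_discounted hγ hv)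

lemma tsum_discounted_mem_Icc {u : ℕ → ℝ} {M : ℝ} (hu : ∀ i, u i ∈ Set.Icc 0 M) :
    ∑' i : ℕ, (1 - γ) * γ ^ i * u i ∈ Set.Icc 0 M := by
  have h0 : ∀ i : ℕ, 0 ≤ (1 - γ) * γ ^ i := fun i =>
    mul_nonneg (sub_pos.2 hγ.2).le (pow_nonneg hγ.1.le i)
  have hM : 0 ≤ M := (hu 0).1.trans (hu 0).2
  refine ⟨tsum_nonneg fun i => mul_nonneg (h0 i) (hu i).1, ?_⟩
  refine (tsum_discounted_mono hγ (C := M) (D := M) (v := fun _ => M)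
    (fun i => by rw [abs_of_nonneg (hu i).1]; exact (hu i).2)
    (fun i => (abs_of_nonneg hM).le) fun i => (hu i).2).trans_eq ?_
  rw [tsum_mul_right, tsum_mul_left, tsum_geometric_of_lt_one hγ.1.le hγ.2,
    mul_inv_cancel₀ (sub_pos.2 hγ.2).ne', one_mul]

variable {S A : Type*} {N : ℕ}

lemma empiricalAverage_le_add_mul (x : Fin N → ℕ → S × A) {f g w : S × A → ℝ} (c : ℝ) {B C D : ℝ}
    (hf : ∀ p, |f p| ≤ B) (hg : ∀ p, |g p| ≤ C) (hw : ∀ p, |w p| ≤ D)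
    (hle : ∀ p, f p ≤ g p + c * w p) :
    empiricalAverage γ x f ≤ empiricalAverage γ x g + c * empiricalAverage γ x w := by
  unfold empiricalAverage
  rw [mul_left_comm, ← mul_add, Finset.mul_sum _ _ c, ← Finset.sum_add_distrib]
  refine mul_le_mul_of_nonneg_left (Finset.sum_le_sum fun e _ => ?_) (by positivity)
  rw [← tsum_mul_left, ← (summable_discounted hγ fun i => hg (x e i)).tsum_add
    ((summable_discounted hγ fun i => hw (x e i)).mul_left c)]
  refine (tsum_discounted_mono hγ (v := fun i => g (x e i) + c * w (x e i)) (D := C + |c| * D)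
    (fun i => hf (x e i)) (fun i => ?_) fun i => hle (x e i)).trans_eq ?_
  · refine (abs_add_le _ _).trans (add_le_add (hg _) ?_)
    rw [abs_mul]
    exact mul_le_mul_of_nonneg_left (hw _) (abs_nonneg c)
  · exact tsum_congr fun i => by ring

end DiscountedAverage

end OffPolicy

open OffPolicy in
theorem theorem1 {S A Ω : Type*} [MeasurableSpace S]
    [MetricSpace A] [SecondCountableTopology A] [MeasurableSpace A] [BorelSpace A]
    [MeasurableSpace Ω] (P : Measure Ω) [IsProbabilityMeasure P]
    -- the Markov decision process
    (γ : ℝ) (hγ : γ ∈ Set.Ioo (0 : ℝ) 1)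
    (T : Kernel (S × A) S) [IsMarkovKernel T]
    (r : S × A → ℝ) (hr : Measurable r) (hrb : ∃ C : ℝ, ∀ p, |r p| ≤ C)
    (ρ₀ : Measure S) [IsProbabilityMeasure ρ₀]
    -- the episodes: their policies and the independent sampled trajectories
    (N : ℕ) (hN : 0 < N)
    (π : Fin N → Kernel S A) [∀ e, IsMarkovKernel (π e)]
    (X : Fin N → Ω → ℕ → S × A)
    (hlaw : ∀ e, HasLaw (X e) (trajLaw T ρ₀ (π e)) P)
    (hindep : iIndepFun X P)
    -- the policy of the last episode
    (πN : Kernel S A) [IsMarkovKernel πN] (hπN : πN = π ⟨N - 1, Nat.sub_one_lt hN.ne'⟩)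
    -- the estimated Q function
    (Qhat : S × A → ℝ) (hQhat : Measurable Qhat)
    (L : ℝ≥0)
    (hLip : ∀ s, LipschitzWith L (fun a => Qhat (s, a)) ∧
      LipschitzWith L (fun a => qFunction γ T r πN (s, a)))
    (rmax : ℝ)
    (hbound : ∀ p, Qhat p ∈ Set.Icc 0 (rmax / (1 - γ)) ∧
      qFunction γ T r πN p ∈ Set.Icc 0 (rmax / (1 - γ)))
    (hdiam : Bornology.IsBounded (Set.univ : Set A))
    (δ : ℝ) (hδ : δ ∈ Set.Ioo (0 : ℝ) 1) :
    ∃ E : Set Ω, MeasurableSet E ∧ ENNReal.ofReal (1 - δ) ≤ P E ∧ ∀ ω ∈ E,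
      ∫ s, ∫ a, |Qhat (s, a) - qFunction γ T r πN (s, a)| ∂(behaviorPolicy γ T ρ₀ π s) ∂ρ₀ ≤
        rmax / (1 - γ) * √(1 / (2 * N) * Real.log (2 / δ))
        + (rmax / (1 - γ) ^ 2 + 2 * L * Metric.diam (Set.univ : Set A) / (1 - γ))
          * √(2 / N * Real.log (2 / δ))
        + 1 / (1 - γ) *
          (empiricalAverage γ (fun e => X e ω) (fun p => |Qhat p - bellman γ T r πN Qhat p|)
            + 2 * L * empiricalAverage γ (fun e => X e ω)
                (fun p => wasserstein1 (πN p.1) (behaviorPolicy γ T ρ₀ π p.1))) := by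
  have hγ1 : 0 < 1 - γ := sub_pos.2 hγ.2
  have hN' : (0 : ℝ) < N := by exact_mod_cast hN
  have := isMarkovKernel_behaviorPolicy γ T ρ₀ π hN
  set R := rmax / (1 - γ) with hRdef
  set Q := qFunction γ T r πN with hQdef
  set d := Metric.diam (Set.univ : Set A) with hd
  have hd0 : 0 ≤ d := Metric.diam_nonneg
  have habs : ∀ {y : ℝ}, y ∈ Set.Icc 0 R → |y| ≤ R := fun hy => (abs_of_nonneg hy.1).trans_le hy.2
  have hrB : BoundedMeasurable r := ⟨hr, hrb⟩
  have hQhatB : BoundedMeasurable Qhat := ⟨hQhat, R, fun p => habs (hbound p).1⟩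
  have hQB : BoundedMeasurable Q :=
    ⟨measurable_qFunction T πN hγ hrB, R, fun p => habs (hbound p).2⟩
  have hfix : ∀ p, Q p = bellman γ T r πN Q p := qFunction_eq_bellman T πN hγ hrB hQB
  set D : S × A → ℝ := fun p => |Qhat p - Q p| with hDdef
  set ε : S × A → ℝ := fun p => |Qhat p - bellman γ T r πN Qhat p| with hεdef
  have hD : BoundedMeasurable D := (hQhatB.sub hQB).abs
  have hε : BoundedMeasurable ε := (hQhatB.sub (boundedMeasurable_bellman γ T πN r hrB hQhatB)).abs
  have hεR : ∀ p, ε p ≤ 2 * R := abs_bellman_residual_le γ T πN r hγ hQhatB hQB hfix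
    (fun p => (hbound p).1) fun p => (hbound p).2
  have hDLip : ∀ s, LipschitzWith (2 * L) fun a => D (s, a) := fun s => by
    have h := (hLip s).1.sub (hLip s).2
    rw [← two_mul] at h
    refine LipschitzWith.of_dist_le_mul fun a b => ?_
    refine le_trans ?_ (h.dist_le_mul a b)
    exact abs_abs_sub_abs_le_abs_sub _ _
  set w : S × A → ℝ := fun p => wasserstein1 (πN p.1) (behaviorPolicy γ T ρ₀ π p.1) with hw
  have hw0 : ∀ p, 0 ≤ w p := fun p => ENNReal.toReal_nonneg
  have hwd : ∀ p, w p ≤ d := fun p => wasserstein1_le_diam _ _ hdiam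
  -- The mismatch of the two policies is measured by a dual gap, which depends measurably on the
  -- state, unlike the Wasserstein distance, for which no measurability is available.
  set gap : S → ℝ := fun s => |∫ a, D (s, a) ∂(πN s) - ∫ a, D (s, a) ∂(behaviorPolicy γ T ρ₀ π s)|
    with hgap
  have hgapB : BoundedMeasurable gap :=
    ((hD.integral_kernel_prod _).sub (hD.integral_kernel_prod _)).abs
  have hgapw : ∀ p : S × A, gap p.1 ≤ 2 * L * w p := fun p => by
    have h := abs_integral_sub_le_wasserstein1 (πN p.1) (behaviorPolicy γ T ρ₀ π p.1) hdiam
      (hDLip p.1) (hD.comp measurable_prodMk_left)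
    push_cast at h
    exact h
  set f : S × A → ℝ := fun p => ε p + gap p.1 with hf
  have hfB : BoundedMeasurable f := hε.add (hgapB.comp measurable_fst)
  have hfM : ∀ p, f p ∈ Set.Icc 0 (2 * R + 2 * L * d) := fun p =>
    ⟨add_nonneg (abs_nonneg _) (abs_nonneg _), add_le_add (hεR p)
      ((hgapw p).trans (mul_le_mul_of_nonneg_left (hwd p) (by positivity)))⟩
  have hmean := integral_behaviorPolicy_le hN hγ T ρ₀ π πN hD hε
    (abs_sub_le_bellman_residual_add γ T πN r hγ.1.le hQhatB hQB hfix)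
  -- The discounted sums along the episodes are independent, bounded, and have the right means.
  set F : (ℕ → S × A) → ℝ := fun x => ∑' i : ℕ, (1 - γ) * γ ^ i * f (x i) with hF
  have hFmeas : Measurable F := by
    obtain ⟨C, hC⟩ := hfB.bounded
    simp_rw [hF, mul_assoc, tsum_mul_left]
    exact (measurable_discounted_sum hγ (fun _ => hfB.measurable) (fun _ => hC)
      measurable_pi_apply).const_mul _
  obtain ⟨E, hE, hPE, hEle⟩ := exists_measurableSet_mean_le P hN (Z := fun e => F ∘ X e)
    (hindep.comp (fun _ => F) fun _ => hFmeas)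
    (fun e => hFmeas.comp_aemeasurable (hlaw e).aemeasurable)
    (fun e ω => tsum_discounted_mem_Icc hγ fun i => hfM (X e ω i)) hδ
  refine ⟨E, hE, hPE, fun ω hω => ?_⟩
  have hEω := hEle ω hω
  have hmeanF : ∀ e, ∫ ω', (F ∘ X e) ω' ∂P = ∫ p, f p ∂(pairOccupancy γ T ρ₀ (π e)) := fun e => by
    rw [(hlaw e).integral_comp hFmeas.aestronglyMeasurable]
    exact integral_discounted_trajLaw hγ T ρ₀ (π e) hfB
  simp_rw [hmeanF] at hEω
  obtain ⟨C, hC⟩ := hfB.bounded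
  obtain ⟨C', hC'⟩ := hε.bounded
  have hemp := empiricalAverage_le_add_mul hγ (fun e => X e ω) (2 * L) hC hC'
    (fun p => (abs_of_nonneg (hw0 p)).trans_le (hwd p)) (w := w)
    fun p => add_le_add le_rfl (hgapw p)
  change empiricalAverage γ (fun e => X e ω) f ≤ _ at hemp
  set I := ∫ s, ∫ a, D (s, a) ∂(behaviorPolicy γ T ρ₀ π s) ∂ρ₀
  have hI : (1 - γ) * I ≤ 1 / (N : ℝ) * ∑ e, ∫ p, f p ∂(pairOccupancy γ T ρ₀ (π e)) := by
    rw [one_div, ← div_eq_inv_mul, le_div_iff₀ hN', mul_comm]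
    exact hmean
  set emp := empiricalAverage γ (fun e => X e ω) ε
    + 2 * L * empiricalAverage γ (fun e => X e ω) w
  set t := √(1 / (2 * N) * Real.log (2 / δ)) with ht
  have ht0 : 0 ≤ t := Real.sqrt_nonneg _
  have htle : √(1 / (2 * N) * Real.log (1 / δ)) ≤ t := by
    refine Real.sqrt_le_sqrt (mul_le_mul_of_nonneg_left ?_ (by positivity))
    exact Real.log_le_log (one_div_pos.2 hδ.1) (div_le_div_of_nonneg_right one_le_two hδ.1.le)
  have ht2 : √(2 / N * Real.log (2 / δ)) = 2 * t := by
    rw [show 2 / (N : ℝ) * Real.log (2 / δ) = 2 ^ 2 * (1 / (2 * N) * Real.log (2 / δ)) by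
      field_simp, Real.sqrt_mul (by norm_num), Real.sqrt_sq (by norm_num)]
  have hR0 : 0 ≤ R := by
    obtain ⟨ω₀⟩ : Nonempty Ω := nonempty_of_isProbabilityMeasure P
    have := (hbound (X ⟨0, hN⟩ ω₀ 0)).1
    exact this.1.trans this.2
  have hMt : (2 * R + 2 * L * d) * √(1 / (2 * N) * Real.log (1 / δ)) ≤ (2 * R + 2 * L * d) * t :=
    mul_le_mul_of_nonneg_left htle (by positivity)
  have hmain : (1 - γ) * I ≤ emp + (2 * R + 2 * L * d) * t := by
    change _ ≤ empiricalAverage γ (fun e => X e ω) f + _ at hEω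
    linarith
  have hdiv : I ≤ (emp + (2 * R + 2 * L * d) * t) / (1 - γ) := by
    rw [le_div_iff₀ hγ1, mul_comm]
    exact hmain
  refine hdiv.trans ?_
  rw [ht2, show rmax / (1 - γ) ^ 2 = R / (1 - γ) by rw [hRdef, div_div, sq]]
  have h1 : 0 ≤ R * t := mul_nonneg hR0 ht0
  have h2 : 0 ≤ 2 * L * d / (1 - γ) * t := by positivity
  have h3 : (emp + (2 * R + 2 * L * d) * t) / (1 - γ)
      = 1 / (1 - γ) * emp + 2 * (R / (1 - γ) * t) + 2 * L * d / (1 - γ) * t := by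
    field_simp
    ring
  rw [h3]
  linarith
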